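/- For a Euclidean space $E$, or a product of two such spaces with the norm $\|(s,t)\|=\max(\|s\|,\|t\|)$, let $\mathcal B_{\rm loc}(E)$ be the space of locally bounded functions $E\to\mathbb R$ with the metric $\rho(g,h)=\sum_{k\ge1}2^{-k}\min\bigl[1,\sup_{\|x\|\le k}|g(x)-h(x)|\bigr]$ of uniform convergence on compacta. Convergence in distribution $X_n\rightsquigarrow X$ is understood in the sense of Hoffmann-Jørgensen: the $X_n$ are arbitrary (possibly nonmeasurable) maps from probability spaces into a metric space $D$, the limit $X$ is Borel measurable up to a null set, and $\mathbb P^*h(X_n)\to \mathbb P h(X)$ for every bounded continuous $h:D\to\mathbb R$, where $\mathbb P^*$ denotes outer expectation (and outer probability). Theorem 1. For each $n$ let $H_n$ be a random function on $\mathbb R^{d_1}\times\mathbb R^{d_2}$ and let $(s_n,t_n)$ be a (possibly nonmeasurable) random vector in $\mathbb R^{d_1}\times\mathbb R^{d_2}$. Suppose that: (i) $H_n(s,t)=\alpha_n f_n(s)+\beta_n g_n(s,t)$ for all $s,t$, where $f_n$ and $g_n$ are random elements (possibly nonmeasurable) of $\mathcal B_{\rm loc}(\mathbb R^{d_1})$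 and $\mathcal B_{\rm loc}(\mathbb R^{d_1}\times\mathbb R^{d_2})$, and $\alpha_n,\beta_n$ are positive numbers with $\beta_n=o(\alpha_n)$; (ii) $(f_n,g_n)\rightsquigarrow(f,g)$ in $\mathcal B_{\rm loc}(\mathbb R^{d_1})\times\mathcal B_{\rm loc}(\mathbb R^{d_1}\times\mathbb R^{d_2})$, and almost all sample paths of $f$ and $g$ are continuous; (iii) $H_n(s_n,t_n)\le\inf_{s,t}H_n(s,t)+o_p^*(\beta_n)$, that is, $\mathbb P^*\{H_n(s_n,t_n)>\inf_{s,t}H_n(s,t)+\varepsilon\beta_n\}\to0$ for every $\varepsilon>0$; (iv) $\|(s_n,t_n)\|=O_p^*(1)$, that is, for every $\varepsilon>0$ there is $M$ with $\mathbb P^*\{\|(s_n,t_n)\|>M\}\le\varepsilon$ for all large $n$. Suppose that, almost surely, $f(\cdot)$ has a unique minimum, at a random point $s^*$, and $g(s^*,\cdot)$ has a unique minimum, at a random point $t^*$. Then $(s_n,t_n)\rightsquigarrow(s^*,t^*)$. -/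

import Mathlib

open Filter Topology MeasureTheory

namespace MixedRates

/-- Locally bounded real functions on `E`. For `E = ℝ^d` closed balls are compact, so being
locally bounded is the same as being bounded on every ball. -/
@[ext]
structure LocBdd (E : Type*) [NormedAddCommGroup E] where
  toFun : E → ℝ
  bounded' : ∀ R : ℝ, ∃ C : ℝ, ∀ x : E, ‖x‖ ≤ R → |toFun x| ≤ C

namespace LocBdd

variable {E : Type*} [NormedAddCommGroup E]

instance : CoeFun (LocBdd E) (fun _ => E → ℝ) := ⟨LocBdd.toFun⟩

/-- `rhoBall k g h` is the supremum of `|g x - h x|` over `‖x‖ ≤ k`. -/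
noncomputable def rhoBall (k : ℕ) (g h : LocBdd E) : ℝ :=
  ⨆ x : {x : E // ‖x‖ ≤ (k : ℝ)}, |g x.1 - h x.1|

/-- The metric for the topology of uniform convergence on compacta,
`∑_{k ≥ 1} 2^{-k} min (1, rhoBall k g h)`. -/
noncomputable def rho (g h : LocBdd E) : ℝ :=
  ∑' k : ℕ, (1 / 2 : ℝ) ^ (k + 1) * min 1 (rhoBall (k + 1) g h)

theorem bddAbove_rhoBall (k : ℕ) (g h : LocBdd E) :
    BddAbove (Set.range fun x : {x : E // ‖x‖ ≤ (k : ℝ)} => |g x.1 - h x.1|) := by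
  obtain ⟨C, hC⟩ := g.bounded' k
  obtain ⟨D, hD⟩ := h.bounded' k
  refine ⟨C + D, ?_⟩
  rintro _ ⟨x, rfl⟩
  exact (abs_sub _ _).trans (add_le_add (hC _ x.2) (hD _ x.2))

theorem le_rhoBall {k : ℕ} (g h : LocBdd E) {x : E} (hx : ‖x‖ ≤ (k : ℝ)) :
    |g x - h x| ≤ rhoBall k g h :=
  le_ciSup (bddAbove_rhoBall k g h) ⟨x, hx⟩

theorem rhoBall_nonneg (k : ℕ) (g h : LocBdd E) : 0 ≤ rhoBall k g h :=
  Real.iSup_nonneg fun _ => abs_nonneg _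

theorem rhoBall_triangle (k : ℕ) (f g h : LocBdd E) :
    rhoBall k f h ≤ rhoBall k f g + rhoBall k g h :=
  Real.iSup_le (fun x => (abs_sub_le _ (g x.1) _).trans
    (add_le_add (le_rhoBall f g x.2) (le_rhoBall g h x.2)))
    (add_nonneg (rhoBall_nonneg _ _ _) (rhoBall_nonneg _ _ _))

theorem rho_term_nonneg (g h : LocBdd E) (k : ℕ) :
    0 ≤ (1 / 2 : ℝ) ^ (k + 1) * min 1 (rhoBall (k + 1) g h) :=
  mul_nonneg (by positivity) (le_min zero_le_one (rhoBall_nonneg _ _ _))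

theorem summable_rho (g h : LocBdd E) :
    Summable fun k : ℕ => (1 / 2 : ℝ) ^ (k + 1) * min 1 (rhoBall (k + 1) g h) := by
  refine Summable.of_nonneg_of_le (rho_term_nonneg g h) (fun k => ?_)
    ((summable_nat_add_iff 1).2 summable_geometric_two)
  exact mul_le_of_le_one_right (by positivity) (min_le_left _ _)

noncomputable instance : MetricSpace (LocBdd E) where
  dist := rho
  dist_self g := by simp [rho, rhoBall]
  dist_comm g h := by simp [rho, rhoBall, abs_sub_comm]
  dist_triangle f g h := by
    change rho f h ≤ rho f g + rho g h
    unfold rho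
    rw [← (summable_rho f g).tsum_add (summable_rho g h)]
    refine (summable_rho f h).tsum_le_tsum (fun k => ?_)
      ((summable_rho f g).add (summable_rho g h))
    rw [← mul_add]
    refine mul_le_mul_of_nonneg_left ?_ (by positivity)
    have h1 := rhoBall_triangle (k + 1) f g h
    have h2 := rhoBall_nonneg (k + 1) f g
    have h3 := rhoBall_nonneg (k + 1) g h
    rcases le_total 1 (rhoBall (k + 1) f g) with h4 | h4 <;>
    rcases le_total 1 (rhoBall (k + 1) g h) with h5 | h5 <;>
    simp only [min_eq_left, min_eq_right, h4, h5] <;>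
    first
      | exact (min_le_left _ _).trans (by linarith)
      | exact (min_le_right _ _).trans (by linarith)
  eq_of_dist_eq_zero := by
    intro g h hgh
    change rho g h = 0 at hgh
    have hs := (summable_rho g h).hasSum
    rw [show (∑' k : ℕ, (1 / 2 : ℝ) ^ (k + 1) * min 1 (rhoBall (k + 1) g h)) = 0 from hgh] at hs
    have h0 := (hasSum_zero_iff_of_nonneg (rho_term_nonneg g h)).1 hs
    ext x
    obtain ⟨k, hk⟩ := exists_nat_ge ‖x‖
    have h1 := congrFun h0 k
    have h2 : rhoBall (k + 1) g h = 0 := by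
      have h3 : min 1 (rhoBall (k + 1) g h) = 0 := by simpa using h1
      rcases min_choice 1 (rhoBall (k + 1) g h) with h4 | h4
      · rw [h4] at h3; exact absurd h3 one_ne_zero
      · rwa [h4] at h3
    have hk' : ‖x‖ ≤ ((k + 1 : ℕ) : ℝ) := by push_cast; linarith
    have h6 := le_rhoBall g h hk'
    rw [h2] at h6
    exact sub_eq_zero.1 (abs_nonpos_iff.1 h6)

end LocBdd

/-- Outer expectation of a bounded, possibly nonmeasurable, real function `T`: the infimum of
`∫ U ∂μ` over measurable integrable `U ≥ T`. -/
noncomputable def outerExp {Ω : Type*} [MeasurableSpace Ω] (μ : Measure Ω) (T : Ω → ℝ) : ℝ :=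
  sInf {I : ℝ | ∃ U : Ω → ℝ, Measurable U ∧ Integrable U μ ∧ (∀ ω, T ω ≤ U ω) ∧ I = ∫ ω, U ω ∂μ}

/-- Convergence in distribution in the sense of Hoffmann-Jørgensen: the maps `X n` are arbitrary
(possibly nonmeasurable, each on its own probability space), the limit `Y` is Borel measurable up
to a null set, and outer expectations of bounded continuous functions converge. -/
structure WeakConv {D : Type*} [TopologicalSpace D]
    {Ω : ℕ → Type*} [∀ n, MeasurableSpace (Ω n)] (μ : ∀ n, Measure (Ω n))
    {Ω' : Type*} [MeasurableSpace Ω'] (ν : Measure Ω')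
    (X : ∀ n, Ω n → D) (Y : Ω' → D) : Prop where
  aemeasurable : @AEMeasurable Ω' D (borel D) _ Y ν
  tendsto : ∀ h : BoundedContinuousFunction D ℝ,
    Tendsto (fun n => outerExp (μ n) (fun ω => h (X n ω))) atTop (𝓝 (∫ ω, h (Y ω) ∂ν))

/-- `X n = O_p^*(1)`: stochastic boundedness in outer probability. (The value of a `Measure` at a
nonmeasurable set is its outer measure.) -/
def BoundedInOuterProb {E : Type*} [NormedAddCommGroup E]
    {Ω : ℕ → Type*} [∀ n, MeasurableSpace (Ω n)] (μ : ∀ n, Measure (Ω n))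
    (X : ∀ n, Ω n → E) : Prop :=
  ∀ ε : ENNReal, 0 < ε → ∃ M : ℝ, ∀ᶠ n in atTop, μ n {ω | M < ‖X n ω‖} ≤ ε

/-- `H n (x n) ≤ inf H n + o_p^*(β n)`: for every `ε > 0` the outer probability of
`{H n (x n) > inf H n + ε * β n}` tends to `0` (the infimum may be `-∞`). -/
def ApproxMinimizer {E : Type*}
    {Ω : ℕ → Type*} [∀ n, MeasurableSpace (Ω n)] (μ : ∀ n, Measure (Ω n))
    (H : ∀ n, Ω n → E → ℝ) (x : ∀ n, Ω n → E) (β : ℕ → ℝ) : Prop :=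
  ∀ ε : ℝ, 0 < ε →
    Tendsto (fun n => μ n {ω | ∃ y : E, H n ω y + ε * β n < H n ω (x n ω)}) atTop (𝓝 0)

/-- `x` is the unique minimum point of `h`. -/
def IsUniqueMin {E : Type*} (h : E → ℝ) (x : E) : Prop :=
  ∀ y : E, y ≠ x → h x < h y

end MixedRates

/-! An approximate minimizer `x` of `a * f + b * g`, with `b / a` small, nearly minimizes the pair
lexicographically. Comparison with points that share its first coordinate cancels `f` and shows that
`x.2` almost minimizes `g (x.1, ·)`. Comparison with points that share its second coordinate, after
division by `a`, shows that `x.1` almost minimizes `f`, up to `b / a` times the size of `g`. The sum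
of the two defects is bounded by `gap`, so `gap` is small at `(s_n, t_n)` (`gap_le_of_approxMin`).

For a bounded continuous `h`, the value of `h` at such a point is therefore at most the supremum
over a ball of `h - R * gap`, plus a small error. This bound is a bounded continuous functional of
`(f_n, g_n)` alone (`continuous_dominant`, `le_dominant_add`), so weak convergence passes it to the
limit. There the paths are continuous and the lexicographic minimum is unique, so as `R` grows
compactness brings the penalized supremum down to at most about `h (s*, t*)`
(`eventually_penalizedSup_le`). Applying the upper bound to `h` and `-h` gives convergence. No
almost sure representation is needed, and measurability matters only for the limit. -/

namespace MixedRates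

/-! ### Continuity of ball suprema and evaluations. -/

namespace LocBdd

variable {E : Type*} [NormedAddCommGroup E]

instance : Zero (LocBdd E) := ⟨⟨fun _ => 0, fun _ => ⟨0, by simp⟩⟩⟩

theorem zero_apply (x : E) : (0 : LocBdd E) x = 0 := rfl

theorem abs_apply_le_rhoBall {k : ℕ} (g : LocBdd E) {x : E} (hx : ‖x‖ ≤ (k : ℝ)) :
    |g x| ≤ rhoBall k g 0 := by
  simpa [zero_apply] using le_rhoBall g 0 hx

theorem rhoBall_comm (k : ℕ) (g h : LocBdd E) : rhoBall k g h = rhoBall k h g := by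
  simp [rhoBall, abs_sub_comm]

theorem rhoBall_le_succ (k : ℕ) (g h : LocBdd E) : rhoBall k g h ≤ rhoBall (k + 1) g h :=
  Real.iSup_le (fun x => le_rhoBall g h (x.2.trans (by push_cast; linarith)))
    (rhoBall_nonneg _ _ _)

theorem tendsto_rhoBall (k : ℕ) (g : LocBdd E) :
    Tendsto (fun h => rhoBall k h g) (𝓝 g) (𝓝 0) := by
  rw [Metric.tendsto_nhds]
  intro ε hε
  have hpos : (0 : ℝ) < (1 / 2) ^ (k + 1) * min 1 ε := by positivity
  filter_upwards [Metric.ball_mem_nhds g hpos] with h hh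
  have h1 : rho h g < (1 / 2) ^ (k + 1) * min 1 ε := hh
  have h2 : (1 / 2 : ℝ) ^ (k + 1) * min 1 (rhoBall (k + 1) h g) ≤ rho h g :=
    -- The term of index `k` carries the ball of radius `k + 1`; truncating `ε` at 1 keeps the
    -- cutoff in the metric from hiding the supremum.
    (summable_rho h g).le_tsum k fun i _ => rho_term_nonneg h g i
  have h3 : min 1 (rhoBall (k + 1) h g) < min 1 ε :=
    lt_of_mul_lt_mul_left (h2.trans_lt h1) (by positivity)
  rw [Real.dist_eq, sub_zero, abs_of_nonneg (rhoBall_nonneg _ _ _)]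
  refine (rhoBall_le_succ k h g).trans_lt ?_
  rcases min_lt_iff.1 h3 with h4 | h4
  · exact absurd h4 (min_le_left _ _).not_gt
  · exact h4.trans_le (min_le_right _ _)

theorem continuous_rhoBall (k : ℕ) (g₀ : LocBdd E) : Continuous fun g => rhoBall k g g₀ := by
  rw [continuous_iff_continuousAt]
  intro g
  rw [ContinuousAt, tendsto_iff_norm_sub_tendsto_zero]
  refine squeeze_zero (fun _ => norm_nonneg _) (fun h => ?_) (tendsto_rhoBall k g)
  rw [Real.norm_eq_abs, abs_le]
  have h1 := rhoBall_triangle k h g g₀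
  have h2 := rhoBall_triangle k g h g₀
  rw [rhoBall_comm k g h] at h2
  constructor <;> linarith

theorem continuous_eval (x : E) : Continuous fun g : LocBdd E => g x := by
  obtain ⟨k, hk⟩ := exists_nat_ge ‖x‖
  rw [continuous_iff_continuousAt]
  intro g
  rw [ContinuousAt, tendsto_iff_norm_sub_tendsto_zero]
  exact squeeze_zero (fun _ => norm_nonneg _) (fun h => le_rhoBall h g hk) (tendsto_rhoBall k g)

end LocBdd

/-! ### Outer expectations. -/

section OuterExpectation

variable {Ω : Type*} [MeasurableSpace Ω] {μ : Measure Ω} [IsProbabilityMeasure μ]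

theorem bddBelow_outerExp {T : Ω → ℝ} {C : ℝ} (hT : ∀ ω, |T ω| ≤ C) :
    BddBelow {I : ℝ | ∃ U : Ω → ℝ, Measurable U ∧ Integrable U μ ∧ (∀ ω, T ω ≤ U ω) ∧
      I = ∫ ω, U ω ∂μ} := by
  refine ⟨-C, ?_⟩
  rintro _ ⟨U, -, hU, hTU, rfl⟩
  have := integral_mono (integrable_const (-C)) hU
    fun ω => (neg_le_of_abs_le (hT ω)).trans (hTU ω)
  simpa using this

theorem exists_integral_lt_outerExp_add {T : Ω → ℝ} {C : ℝ} (hT : ∀ ω, |T ω| ≤ C) {ε : ℝ}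
    (hε : 0 < ε) : ∃ U : Ω → ℝ, Measurable U ∧ Integrable U μ ∧ (∀ ω, T ω ≤ U ω) ∧
      ∫ ω, U ω ∂μ < outerExp μ T + ε := by
  obtain ⟨_, ⟨U, h1, h2, h3, rfl⟩, h4⟩ := Real.lt_sInf_add_pos
    (s := {I : ℝ | ∃ U : Ω → ℝ, Measurable U ∧ Integrable U μ ∧ (∀ ω, T ω ≤ U ω) ∧
      I = ∫ ω, U ω ∂μ})
    ⟨_, fun _ => C, measurable_const, integrable_const C, fun ω => le_of_abs_le (hT ω), rfl⟩ hε
  exact ⟨U, h1, h2, h3, h4⟩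

/-- Outer expectation is monotone and subadditive, in the form of an estimate that holds up to a
constant and off an exceptional set. -/
theorem outerExp_le_add {S T : Ω → ℝ} {C C' : ℝ} (hT : ∀ ω, |T ω| ≤ C) (hS : ∀ ω, |S ω| ≤ C')
    {A : Set Ω} {a c : ℝ} (hgood : ∀ ω, ω ∉ A → T ω ≤ S ω + a)
    (hbad : ∀ ω, T ω ≤ S ω + a + c) :
    outerExp μ T ≤ outerExp μ S + a + c * μ.real A := by
  refine le_of_forall_pos_le_add fun ε hε => ?_
  obtain ⟨U, hU, hUi, hSU, hUε⟩ := exists_integral_lt_outerExp_add (μ := μ) hS hε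
  -- `A` may be nonmeasurable; its measurable hull has the same measure and yields a measurable
  -- majorant.
  set B := toMeasurable μ A
  have hB : MeasurableSet B := measurableSet_toMeasurable _ _
  have hi : Integrable (B.indicator fun _ => c) μ := (integrable_const c).indicator hB
  have h1 : outerExp μ T ≤ ∫ ω, (U ω + a) + B.indicator (fun _ => c) ω ∂μ := by
    refine csInf_le (bddBelow_outerExp hT) ⟨_, ?_, (hUi.add (integrable_const a)).add hi, ?_, rfl⟩
    · exact (hU.add_const a).add (measurable_const.indicator hB)
    · intro ω
      by_cases h : ω ∈ B
      · change T ω ≤ U ω + a + B.indicator (fun _ => c) ω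
        rw [Set.indicator_of_mem h]
        linarith [hbad ω, hSU ω]
      · change T ω ≤ U ω + a + B.indicator (fun _ => c) ω
        rw [Set.indicator_of_notMem h]
        linarith [hgood ω fun hA => h (subset_toMeasurable μ A hA), hSU ω]
  rw [integral_add (f := fun ω => U ω + a) (hUi.add (integrable_const a)) hi,
    integral_add hUi (integrable_const a),
    integral_indicator_const _ hB, integral_const] at h1
  have h2 : μ.real B = μ.real A := by simp [Measure.real, B, measure_toMeasurable]
  rw [h2] at h1
  simp only [probReal_univ, smul_eq_mul, one_mul] at h1
  linarith

/-- Inner expectation is at most outer expectation, so an upper bound for `-T` becomes a lower bound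
for `T`. -/
theorem neg_outerExp_neg_le {T : Ω → ℝ} {C : ℝ} (hT : ∀ ω, |T ω| ≤ C) :
    -outerExp μ (fun ω => -T ω) ≤ outerExp μ T := by
  refine le_of_forall_pos_le_add fun ε hε => ?_
  obtain ⟨U, -, hU, hTU, hUε⟩ := exists_integral_lt_outerExp_add (μ := μ) hT (half_pos hε)
  obtain ⟨V, -, hV, hTV, hVε⟩ := exists_integral_lt_outerExp_add (μ := μ) (T := fun ω => -T ω)
    (fun ω => (abs_neg (T ω)).trans_le (hT ω)) (half_pos hε)
  have : 0 ≤ ∫ ω, U ω + V ω ∂μ := integral_nonneg fun ω => by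
    have := hTU ω
    have := hTV ω
    simp only [Pi.zero_apply]
    linarith
  rw [integral_add hU hV] at this
  linarith

end OuterExpectation

/-! ### Measurability of minimum points and of evaluation at them. -/

section Measurability

variable {Ω : Type*} [MeasurableSpace Ω] {ν : Measure Ω}

/-- The unique minimum point of a random continuous function is measurable. -/
theorem aemeasurable_of_isUniqueMin {X : Type*} [MetricSpace X] [ProperSpace X] [Nonempty X]
    [MeasurableSpace X] [BorelSpace X] {φ : Ω → X → ℝ} {x : Ω → X}
    (hφ : ∀ y, AEMeasurable (fun ω => φ ω y) ν) (hc : ∀ᵐ ω ∂ν, Continuous (φ ω))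
    (hx : ∀ᵐ ω ∂ν, IsUniqueMin (φ ω) (x ω)) : AEMeasurable x ν := by
  have key : ∀ K : Set X, IsCompact K → NullMeasurableSet (x ⁻¹' K) ν := by
    intro K hK
    obtain ⟨D, hDc, hD⟩ := TopologicalSpace.exists_countable_dense X
    obtain ⟨S, hSc, hS⟩ := TopologicalSpace.exists_countable_dense K
    -- By continuity and uniqueness, the minimum point lies in `K` exactly when the infimum over `K`
    -- does not exceed the values on a dense set; countable dense sets suffice to test this.
    have hmeas : NullMeasurableSet
        (⋂ y ∈ D, ⋂ m : ℕ, ⋃ z ∈ S, {ω | φ ω z.1 < φ ω y + 1 / ((m : ℝ) + 1)}) ν :=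
      .biInter hDc fun y _ => .iInter fun m => .biUnion hSc fun z _ =>
        nullMeasurableSet_lt (hφ _) ((hφ y).add_const _)
    refine hmeas.congr ?_
    filter_upwards [hc, hx] with ω hcω hxω
    refine propext ?_
    change (ω ∈ ⋂ y ∈ D, ⋂ m : ℕ, ⋃ z ∈ S, {ω | φ ω z.1 < φ ω y + 1 / ((m : ℝ) + 1)}) ↔ x ω ∈ K
    have hle : ∀ y, φ ω (x ω) ≤ φ ω y := fun y => by
      rcases eq_or_ne y (x ω) with rfl | h
      exacts [le_rfl, (hxω y h).le]
    simp only [Set.mem_iInter, Set.mem_iUnion, Set.mem_ofPred_eq, exists_prop]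
    constructor
    · intro h
      obtain ⟨y₀, hy₀⟩ := hD.nonempty
      obtain ⟨z₀, -, -⟩ := h y₀ hy₀ 0
      obtain ⟨k, hkK, hk⟩ := hK.exists_isMinOn ⟨z₀.1, z₀.2⟩ hcω.continuousOn
      have h1 : ∀ y ∈ D, φ ω k ≤ φ ω y := fun y hy => by
        refine le_of_forall_pos_le_add fun ε hε => ?_
        obtain ⟨m, hm⟩ := exists_nat_one_div_lt hε
        obtain ⟨z, -, hz⟩ := h y hy m
        have : φ ω k ≤ φ ω z.1 := hk z.2
        linarith
      have h2 : φ ω k ≤ φ ω (x ω) :=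
        (isClosed_le continuous_const hcω).closure_subset_iff.2 h1 (hD (x ω))
      by_contra hn
      exact (hxω k fun e => hn (e ▸ hkK)).not_ge h2
    · intro h y _ m
      have hopen : IsOpen {z : K | φ ω z.1 < φ ω y + 1 / ((m : ℝ) + 1)} :=
        isOpen_lt (hcω.comp continuous_subtype_val) continuous_const
      obtain ⟨z, hz, hzS⟩ := hS.inter_open_nonempty _ hopen
        ⟨⟨x ω, h⟩, (hle y).trans_lt (lt_add_of_pos_right _ (by positivity))⟩
      exact ⟨z, hzS, hz⟩
  have hclosed : ∀ F : Set X, IsClosed F → NullMeasurableSet (x ⁻¹' F) ν := fun F hF => by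
    rw [← Set.univ_inter F, ← iUnion_compactCovering, Set.iUnion_inter, Set.preimage_iUnion]
    exact .iUnion fun n => key _ ((isCompact_compactCovering X n).inter_right hF)
  have hnull : NullMeasurable x ν :=
    @measurable_of_isClosed X (NullMeasurableSpace Ω ν) _ _ _ _ x hclosed
  exact hnull.aemeasurable

/-- A random function with continuous paths may be evaluated measurably at a random point. -/
theorem aemeasurable_eval {X : Type*} [MetricSpace X] [SecondCountableTopology X]
    [MeasurableSpace X] [BorelSpace X] {φ ψ : Ω → X → ℝ} {x : Ω → X}
    (hψ : ∀ y, Measurable fun ω => ψ ω y) (hφψ : ∀ᵐ ω ∂ν, φ ω = ψ ω)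
    (hc : ∀ᵐ ω ∂ν, Continuous (φ ω)) (hx : AEMeasurable x ν) :
    AEMeasurable (fun ω => φ ω (x ω)) ν := by
  set A := toMeasurable ν {ω | ¬(φ ω = ψ ω ∧ Continuous (φ ω))}
  have hA : MeasurableSet A := measurableSet_toMeasurable _ _
  have hA0 : ν A = 0 := by
    rw [measure_toMeasurable]
    exact ae_iff.1 (hφψ.and hc)
  have hgood : ∀ ω, ω ∉ A → φ ω = ψ ω ∧ Continuous (φ ω) := fun ω h => by
    by_contra hn
    exact h (subset_toMeasurable _ _ hn)
  -- Setting the function to zero on the null set `A` makes every path continuous, hence `u` jointly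
  -- measurable.
  let u : X → Ω → ℝ := fun y ω => Aᶜ.indicator (fun ω => ψ ω y) ω
  have hu : Measurable (Function.uncurry u) := by
    refine measurable_uncurry_of_continuous_of_measurable (fun ω => ?_) fun y =>
      (hψ y).indicator hA.compl
    by_cases h : ω ∈ A
    · simpa [u, h] using continuous_const
    · simpa [u, h, ← (hgood ω h).1] using (hgood ω h).2
  refine (hu.comp_aemeasurable (hx.prodMk aemeasurable_id)).congr ?_
  filter_upwards [measure_eq_zero_iff_ae_notMem.1 hA0] with ω hω
  simp [u, hω, (hgood ω hω).1]

end Measurability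

/-! ### The lexicographic gap. -/

theorem abs_iSup_sub_iSup_le {ι : Type*} [Nonempty ι] {a b : ι → ℝ}
    (ha : BddAbove (Set.range a)) (hb : BddAbove (Set.range b)) {c : ℝ}
    (h : ∀ i, |a i - b i| ≤ c) : |iSup a - iSup b| ≤ c := by
  have h1 : iSup a ≤ iSup b + c := ciSup_le fun i => by
    linarith [le_ciSup hb i, le_of_abs_le (h i)]
  have h2 : iSup b ≤ iSup a + c := ciSup_le fun i => by
    linarith [le_ciSup ha i, neg_le_of_abs_le (h i)]
  rw [abs_le]
  constructor <;> linarith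

section Gap

variable {E F : Type*} [NormedAddCommGroup E] [NormedAddCommGroup F]

instance (k : ℕ) : Nonempty {z : E // ‖z‖ ≤ (k : ℝ)} := ⟨⟨0, by simp⟩⟩

/-- How far `x` is from minimizing lexicographically the pair `p` over the ball of radius `R`. -/
noncomputable def gap (R : ℕ) (p : LocBdd E × LocBdd (E × F)) (x : E × F) : ℝ :=
  ⨆ z : {z : E × F // ‖z‖ ≤ (R : ℝ)}, (p.1 x.1 - p.1 z.1.1 + (p.2 x - p.2 (x.1, z.1.2)))

variable {R : ℕ} {x z : E × F}

theorem norm_mk_le (hx : ‖x‖ ≤ (R : ℝ)) (hz : ‖z‖ ≤ (R : ℝ)) : ‖(x.1, z.2)‖ ≤ (R : ℝ) :=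
  max_le ((norm_fst_le x).trans hx) ((norm_snd_le z).trans hz)

theorem bddAbove_gap (p : LocBdd E × LocBdd (E × F)) (hx : ‖x‖ ≤ (R : ℝ)) :
    BddAbove (Set.range fun z : {z : E × F // ‖z‖ ≤ (R : ℝ)} =>
      p.1 x.1 - p.1 z.1.1 + (p.2 x - p.2 (x.1, z.1.2))) := by
  refine ⟨p.1 x.1 + p.1.rhoBall R 0 + (p.2 x + p.2.rhoBall R 0), ?_⟩
  rintro _ ⟨z, rfl⟩
  have h1 := neg_le_of_abs_le (p.1.abs_apply_le_rhoBall ((norm_fst_le z.1).trans z.2))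
  have h2 := neg_le_of_abs_le (p.2.abs_apply_le_rhoBall (norm_mk_le hx z.2))
  dsimp only
  linarith

theorem le_gap (p : LocBdd E × LocBdd (E × F)) (hx : ‖x‖ ≤ (R : ℝ)) (hz : ‖z‖ ≤ (R : ℝ)) :
    p.1 x.1 - p.1 z.1 + (p.2 x - p.2 (x.1, z.2)) ≤ gap R p x :=
  le_ciSup (bddAbove_gap p hx) ⟨z, hz⟩

theorem gap_nonneg (p : LocBdd E × LocBdd (E × F)) (hx : ‖x‖ ≤ (R : ℝ)) : 0 ≤ gap R p x := by
  simpa using le_gap p hx hx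

/-- Each function is evaluated twice, always inside the ball of radius `R`. The bound is uniform in
`x` and needs no continuity of the paths. -/
theorem abs_gap_sub_gap_le (p q : LocBdd E × LocBdd (E × F)) (hx : ‖x‖ ≤ (R : ℝ)) :
    |gap R p x - gap R q x| ≤ 2 * p.1.rhoBall R q.1 + 2 * p.2.rhoBall R q.2 := by
  refine abs_iSup_sub_iSup_le (bddAbove_gap p hx) (bddAbove_gap q hx) fun z => ?_
  have h1 := abs_le.1 (LocBdd.le_rhoBall p.1 q.1 ((norm_fst_le x).trans hx))
  have h2 := abs_le.1 (LocBdd.le_rhoBall p.1 q.1 ((norm_fst_le z.1).trans z.2))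
  have h3 := abs_le.1 (LocBdd.le_rhoBall p.2 q.2 hx)
  have h4 := abs_le.1 (LocBdd.le_rhoBall p.2 q.2 (norm_mk_le hx z.2))
  rw [abs_le]
  constructor <;> linarith [h1.1, h1.2, h2.1, h2.2, h3.1, h3.2, h4.1, h4.2]

/-- An approximate minimizer of `a f + b g` has a small gap. -/
theorem gap_le_of_approxMin {p : LocBdd E × LocBdd (E × F)} {a b η δ : ℝ} (ha : 0 < a)
    (hb : 0 < b) (hη1 : η ≤ 1) (hδ : b / a ≤ δ) (hx : ‖x‖ ≤ (R : ℝ))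
    (hmin : ∀ y : E × F, a * p.1 x.1 + b * p.2 x ≤ a * p.1 y.1 + b * p.2 y + η * b) :
    gap R p x ≤ η + δ * (2 * p.2.rhoBall R 0 + 1) := by
  refine ciSup_le fun z => ?_
  -- Same first coordinate: the `a` terms cancel.
  have h1 : p.2 x - p.2 (x.1, z.1.2) ≤ η := by
    have := hmin (x.1, z.1.2)
    refine le_of_mul_le_mul_left ?_ hb
    linarith
  have hzx : ‖(z.1.1, x.2)‖ ≤ (R : ℝ) := norm_mk_le z.2 hx
  have h2 := neg_le_of_abs_le (p.2.abs_apply_le_rhoBall hx)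
  have h3 := le_of_abs_le (p.2.abs_apply_le_rhoBall hzx)
  have hN := LocBdd.rhoBall_nonneg R p.2 0
  -- Same second coordinate: `g` varies by at most twice its supremum, and `η ≤ 1` supplies the
  -- extra 1.
  have h4 : p.1 x.1 - p.1 z.1.1 ≤ b / a * (2 * p.2.rhoBall R 0 + 1) := by
    have h5 := hmin (z.1.1, x.2)
    rw [div_mul_eq_mul_div, le_div_iff₀ ha]
    have h6 : b * (p.2 (z.1.1, x.2) - p.2 x + η) ≤ b * (2 * p.2.rhoBall R 0 + 1) :=
      mul_le_mul_of_nonneg_left (by linarith) hb.le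
    dsimp only at h5
    linarith
  have h5 := mul_le_mul_of_nonneg_right hδ (show 0 ≤ 2 * p.2.rhoBall R 0 + 1 by linarith)
  linarith

end Gap

/-! ### Penalized suprema and the dominating functional. -/

section Penalty

variable {E F : Type*} [NormedAddCommGroup E] [NormedAddCommGroup F]

/-- The supremum of `h` over the ball of radius `M`, penalized by the gap. -/
noncomputable def penalizedSup (M R : ℕ) (h : E × F → ℝ) (p : LocBdd E × LocBdd (E × F)) : ℝ :=
  ⨆ x : {x : E × F // ‖x‖ ≤ (M : ℝ)}, (h x - R * gap R p x)

variable {M R : ℕ} {h : E × F → ℝ} {C : ℝ}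

theorem sub_gap_le (hMR : M ≤ R) (hh : ∀ x, h x ≤ C) (p : LocBdd E × LocBdd (E × F))
    (x : {x : E × F // ‖x‖ ≤ (M : ℝ)}) : h x - R * gap R p x ≤ C := by
  have := mul_nonneg R.cast_nonneg
    (gap_nonneg p (x.2.trans (Nat.cast_le.2 hMR)) : 0 ≤ gap R p x.1)
  linarith [hh x]

theorem bddAbove_penalizedSup (hMR : M ≤ R) (hh : ∀ x, h x ≤ C)
    (p : LocBdd E × LocBdd (E × F)) :
    BddAbove (Set.range fun x : {x : E × F // ‖x‖ ≤ (M : ℝ)} => h x - R * gap R p x) := by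
  refine ⟨C, ?_⟩
  rintro _ ⟨x, rfl⟩
  exact sub_gap_le hMR hh p x

theorem penalizedSup_le (hMR : M ≤ R) (hh : ∀ x, h x ≤ C) (p : LocBdd E × LocBdd (E × F)) :
    penalizedSup M R h p ≤ C :=
  ciSup_le (sub_gap_le hMR hh p)

theorem continuous_penalizedSup (hMR : M ≤ R) (hh : ∀ x, h x ≤ C) :
    Continuous (penalizedSup M R h : LocBdd E × LocBdd (E × F) → ℝ) := by
  rw [continuous_iff_continuousAt]
  intro p
  rw [ContinuousAt, tendsto_iff_norm_sub_tendsto_zero]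
  have hlim : Tendsto (fun q : LocBdd E × LocBdd (E × F) =>
      R * (2 * q.1.rhoBall R p.1 + 2 * q.2.rhoBall R p.2)) (𝓝 p) (𝓝 0) := by
    have h1 := (LocBdd.tendsto_rhoBall R p.1).comp (continuous_fst.tendsto p)
    have h2 := (LocBdd.tendsto_rhoBall R p.2).comp (continuous_snd.tendsto p)
    simpa using ((h1.const_mul 2).add (h2.const_mul 2)).const_mul (R : ℝ)
  refine squeeze_zero (fun _ => norm_nonneg _) (fun q => ?_) hlim
  refine abs_iSup_sub_iSup_le (bddAbove_penalizedSup hMR hh q) (bddAbove_penalizedSup hMR hh p)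
    fun x => ?_
  rw [show h x - R * gap R q x - (h x - R * gap R p x) = -(R * (gap R q x - gap R p x)) by ring,
    abs_neg, abs_mul, Nat.abs_cast]
  exact mul_le_mul_of_nonneg_left
    (abs_gap_sub_gap_le q p (x.2.trans (Nat.cast_le.2 hMR))) R.cast_nonneg

/-- As the penalty grows, the penalized supremum is asymptotically at most the value of `h` at the
lexicographic minimum point. -/
theorem eventually_penalizedSup_le [ProperSpace E] [ProperSpace F] (M : ℕ) (hc : Continuous h)
    (hh : ∀ x, |h x| ≤ C) {p : LocBdd E × LocBdd (E × F)} (hp₁ : Continuous p.1)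
    (hp₂ : Continuous p.2) {s : E} {t : F} (hs : IsUniqueMin p.1 s)
    (ht : IsUniqueMin (fun t => p.2 (s, t)) t) {ε : ℝ} (hε : 0 < ε) :
    ∀ᶠ R : ℕ in atTop, max (-C) (penalizedSup M R h p) ≤ h (s, t) + ε := by
  set K : Set (E × F) := Metric.closedBall 0 M ∩ {x | h (s, t) + ε ≤ h x}
  have hK : IsCompact K :=
    (isCompact_closedBall 0 _).inter_right (isClosed_le continuous_const hc)
  -- Both entries are lower bounds for the gap, obtained from the competitors `(s, x.2)` and `(x.1,
  -- t)`. Away from `(s, t)` at least one is positive, so compactness bounds `q` below on `K`.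
  let q : E × F → ℝ := fun x => max (p.1 x.1 - p.1 s) (p.2 x - p.2 (x.1, t))
  have hq : Continuous q :=
    ((hp₁.comp continuous_fst).sub continuous_const).max
      (hp₂.sub (hp₂.comp (continuous_fst.prodMk continuous_const)))
  have hqpos : ∀ x ∈ K, 0 < q x := by
    intro x hx
    by_cases h1 : x.1 = s
    · have h2 : x.2 ≠ t := by
        rintro h2
        have h3 : x = (s, t) := Prod.ext h1 h2
        have h4 : h (s, t) + ε ≤ h x := hx.2
        rw [h3] at h4
        linarith
      have h3 : p.2 (s, t) < p.2 (s, x.2) := ht _ h2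
      refine lt_max_of_lt_right ?_
      rw [h1]
      rw [← h1] at h3 ⊢
      linarith
    · exact lt_max_of_lt_left (sub_pos.2 (hs _ h1))
  obtain ⟨c, hc0, hcK⟩ : ∃ c : ℝ, 0 < c ∧ ∀ x ∈ K, c ≤ q x := by
    rcases K.eq_empty_or_nonempty with h0 | h0
    · exact ⟨1, one_pos, by simp [h0]⟩
    · obtain ⟨x, hx, hmin⟩ := hK.exists_isMinOn h0 hq.continuousOn
      exact ⟨q x, hqpos x hx, fun y hy => hmin hy⟩
  obtain ⟨N₁, hN₁⟩ := exists_nat_ge ‖(s, t)‖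
  -- Once `R * c ≥ 2 * C`, the penalty on `K` outweighs the whole range of `h`.
  obtain ⟨N₂, hN₂⟩ := exists_nat_ge (2 * C / c)
  filter_upwards [eventually_ge_atTop M, eventually_ge_atTop N₁, eventually_ge_atTop N₂]
    with R hM hR₁ hR₂
  have hst : ‖(s, t)‖ ≤ (R : ℝ) := hN₁.trans (Nat.cast_le.2 hR₁)
  have hst' := neg_le_of_abs_le (hh (s, t))
  refine max_le (by linarith) (ciSup_le fun x => ?_)
  have hxR : ‖x.1‖ ≤ (R : ℝ) := x.2.trans (Nat.cast_le.2 hM)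
  by_cases hxK : x.1 ∈ K
  · have h1 : q x ≤ gap R p x := by
      refine max_le ?_ ?_
      · simpa using le_gap p hxR (norm_mk_le hst hxR)
      · simpa using le_gap p hxR (norm_mk_le hxR hst)
    have h2 : 2 * C ≤ R * c := by
      rw [← div_le_iff₀ hc0]
      exact hN₂.trans (Nat.cast_le.2 hR₂)
    have h3 : (R : ℝ) * c ≤ R * gap R p x :=
      mul_le_mul_of_nonneg_left ((hcK _ hxK).trans h1) R.cast_nonneg
    have h4 := le_of_abs_le (hh x)
    linarith
  · have h1 : h x < h (s, t) + ε := by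
      by_contra hn
      exact hxK ⟨by simpa using x.2, not_lt.1 hn⟩
    have h2 := mul_nonneg R.cast_nonneg (gap_nonneg p hxR)
    linarith

/-- The functional that dominates the value of `h` at an approximate minimizer. -/
noncomputable def dominant (M R : ℕ) (C δ : ℝ) (h : E × F → ℝ)
    (p : LocBdd E × LocBdd (E × F)) : ℝ :=
  max (-C) (penalizedSup M R h p) + min (2 * C) (R * δ * (2 * p.2.rhoBall R 0 + 1))

theorem continuous_dominant (hMR : M ≤ R) (hh : ∀ x, h x ≤ C) (δ : ℝ) :
    Continuous (dominant M R C δ h) := by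
  refine (continuous_const.max (continuous_penalizedSup hMR hh)).add (continuous_const.min ?_)
  exact continuous_const.mul
    ((continuous_const.mul ((LocBdd.continuous_rhoBall R 0).comp continuous_snd)).add
      continuous_const)

theorem abs_max_penalizedSup_le (hMR : M ≤ R) (hh : ∀ x, |h x| ≤ C)
    (p : LocBdd E × LocBdd (E × F)) : |max (-C) (penalizedSup M R h p)| ≤ C := by
  have hC : 0 ≤ C := (abs_nonneg _).trans (hh 0)
  exact abs_le.2 ⟨le_max_left _ _,
    max_le (by linarith) (penalizedSup_le hMR (fun x => le_of_abs_le (hh x)) p)⟩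

theorem min_error_mem (hC : 0 ≤ C) {δ : ℝ} (hδ : 0 ≤ δ) (p : LocBdd E × LocBdd (E × F)) :
    0 ≤ min (2 * C) (R * δ * (2 * p.2.rhoBall R 0 + 1)) := by
  have := LocBdd.rhoBall_nonneg R p.2 0
  positivity

theorem abs_dominant_le (hMR : M ≤ R) (hh : ∀ x, |h x| ≤ C) {δ : ℝ} (hδ : 0 ≤ δ)
    (p : LocBdd E × LocBdd (E × F)) : |dominant M R C δ h p| ≤ 3 * C := by
  have hC : 0 ≤ C := (abs_nonneg _).trans (hh 0)
  have h1 := abs_max_penalizedSup_le hMR hh p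
  have h2 := min_error_mem (R := R) hC hδ p
  have h3 := min_le_left (2 * C) (R * δ * (2 * p.2.rhoBall R 0 + 1))
  refine (abs_add_le _ _).trans ?_
  rw [abs_of_nonneg h2]
  linarith

theorem neg_le_dominant (hh : ∀ x, |h x| ≤ C) {δ : ℝ} (hδ : 0 ≤ δ)
    (p : LocBdd E × LocBdd (E × F)) : -C ≤ dominant M R C δ h p :=
  le_add_of_le_of_nonneg (le_max_left _ _)
    (min_error_mem ((abs_nonneg _).trans (hh 0)) hδ p)

/-- Write `h x` as its penalized value plus `R` times the gap. Truncating the error at `2 * C` is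
harmless: with the floor `-C`, the sum is then already at least `C`. -/
theorem le_dominant_add (hMR : M ≤ R) (hh : ∀ x, |h x| ≤ C) {p : LocBdd E × LocBdd (E × F)}
    {x : E × F} {a b η δ : ℝ} (ha : 0 < a) (hb : 0 < b) (hη : 0 ≤ η) (hη1 : η ≤ 1)
    (hδ : b / a ≤ δ) (hx : ‖x‖ ≤ (M : ℝ))
    (hmin : ∀ y : E × F, a * p.1 x.1 + b * p.2 x ≤ a * p.1 y.1 + b * p.2 y + η * b) :
    h x ≤ dominant M R C δ h p + R * η := by
  have hg := mul_le_mul_of_nonneg_left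
    (gap_le_of_approxMin ha hb hη1 hδ (hx.trans (Nat.cast_le.2 hMR)) hmin)
    (R.cast_nonneg : (0 : ℝ) ≤ R)
  have h1 : h x - R * gap R p x ≤ penalizedSup M R h p :=
    le_ciSup (bddAbove_penalizedSup hMR (fun x => le_of_abs_le (hh x)) p) ⟨x, hx⟩
  have h2 := le_max_left (-C) (penalizedSup M R h p)
  have h3 := le_max_right (-C) (penalizedSup M R h p)
  have h4 := le_of_abs_le (hh x)
  have h5 : 0 ≤ R * η := by positivity
  unfold dominant
  rcases min_choice (2 * C) (R * δ * (2 * p.2.rhoBall R 0 + 1)) with h | h <;> rw [h] <;> linarith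

end Penalty

/-! ### Passage to the limit. -/

section Limit

variable {E F : Type*} [NormedAddCommGroup E] [NormedAddCommGroup F]
  {Ω' : Type*} [MeasurableSpace Ω'] {ν : Measure Ω'}
  {f : Ω' → LocBdd E} {g : Ω' → LocBdd (E × F)}

theorem aestronglyMeasurable_comp {D : Type*} [TopologicalSpace D] {Y : Ω' → D}
    (hY : @AEMeasurable Ω' D (borel D) _ Y ν) {φ : D → ℝ} (hφ : Continuous φ) :
    AEStronglyMeasurable (fun ω => φ (Y ω)) ν := by
  let _ : MeasurableSpace D := borel D
  have _ : BorelSpace D := ⟨rfl⟩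
  exact (hφ.measurable.comp_aemeasurable hY).aestronglyMeasurable

/-- The lexicographic minimum point of a random pair of continuous functions is measurable. -/
theorem aemeasurable_lexMin [ProperSpace E] [ProperSpace F] [MeasurableSpace E] [BorelSpace E]
    [MeasurableSpace F] [BorelSpace F] {s : Ω' → E} {t : Ω' → F}
    (hfg : @AEMeasurable Ω' (LocBdd E × LocBdd (E × F)) (borel _) _ (fun ω => (f ω, g ω)) ν)
    (hcont : ∀ᵐ ω ∂ν, Continuous (f ω) ∧ Continuous (g ω))
    (hs : ∀ᵐ ω ∂ν, IsUniqueMin (f ω) (s ω))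
    (ht : ∀ᵐ ω ∂ν, IsUniqueMin (fun t => g ω (s ω, t)) (t ω)) :
    AEMeasurable s ν ∧ AEMeasurable t ν := by
  have hs' : AEMeasurable s ν := aemeasurable_of_isUniqueMin (φ := fun ω => f ω)
    (fun y => (aestronglyMeasurable_comp hfg
      ((LocBdd.continuous_eval y).comp continuous_fst)).aemeasurable)
    (hcont.mono fun _ h => h.1) hs
  refine ⟨hs', aemeasurable_of_isUniqueMin (φ := fun ω t => g ω (s ω, t)) (fun y => ?_)
    (hcont.mono fun ω h => h.2.comp (continuous_const.prodMk continuous_id)) ht⟩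
  -- One measurable version of the whole pair gives a single null set valid for all evaluation
  -- points.
  obtain ⟨Y, hY, hYe⟩ := hfg
  refine aemeasurable_eval (φ := fun ω x => g ω (x, y)) (ψ := fun ω x => (Y ω).2 (x, y))
    (fun x => ?_) ?_ (hcont.mono fun ω h => h.2.comp (continuous_id.prodMk continuous_const)) hs'
  · let _ : MeasurableSpace (LocBdd E × LocBdd (E × F)) := borel _
    have _ : BorelSpace (LocBdd E × LocBdd (E × F)) := ⟨rfl⟩
    exact ((LocBdd.continuous_eval (x, y)).comp
      (continuous_snd (X := LocBdd E))).measurable.comp hY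
  · filter_upwards [hYe] with ω h
    rw [← h]

theorem integrable_of_abs_le [IsFiniteMeasure ν] {φ : Ω' → ℝ} {C : ℝ}
    (hφ : AEStronglyMeasurable φ ν)
    (hC : ∀ ω, |φ ω| ≤ C) : Integrable φ ν :=
  Integrable.of_bound hφ C (.of_forall hC)

/-- The order of choice matters: `R` makes the penalized supremum nearly optimal, then `δ`,
depending on `R`, makes the error term small. Both limits are by dominated convergence. -/
theorem exists_integral_dominant_le [IsProbabilityMeasure ν] [ProperSpace E] [ProperSpace F]
    {h : E × F → ℝ} {C : ℝ} (hc : Continuous h) (hh : ∀ x, |h x| ≤ C) {s : Ω' → E} {t : Ω' → F}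
    (hfg : @AEMeasurable Ω' (LocBdd E × LocBdd (E × F)) (borel _) _ (fun ω => (f ω, g ω)) ν)
    (hcont : ∀ᵐ ω ∂ν, Continuous (f ω) ∧ Continuous (g ω))
    (hs : ∀ᵐ ω ∂ν, IsUniqueMin (f ω) (s ω))
    (ht : ∀ᵐ ω ∂ν, IsUniqueMin (fun t => g ω (s ω, t)) (t ω))
    (hst : AEStronglyMeasurable (fun ω => h (s ω, t ω)) ν) (M : ℕ) {ε : ℝ} (hε : 0 < ε) :
    ∃ R : ℕ, M ≤ R ∧ ∃ δ : ℝ, 0 < δ ∧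
      ∫ ω, dominant M R C δ h (f ω, g ω) ∂ν ≤ ∫ ω, h (s ω, t ω) ∂ν + ε := by
  have hC : 0 ≤ C := (abs_nonneg _).trans (hh 0)
  have hlehC : ∀ x, h x ≤ C := fun x => le_of_abs_le (hh x)
  have hmeas : ∀ R, M ≤ R → AEStronglyMeasurable
      (fun ω => max (-C) (penalizedSup M R h (f ω, g ω))) ν := fun R hR =>
    aestronglyMeasurable_comp hfg (continuous_const.max (continuous_penalizedSup hR hlehC))
  obtain ⟨R, hMR, hR⟩ : ∃ R : ℕ, M ≤ R ∧
      ∫ ω, max (-C) (penalizedSup M R h (f ω, g ω)) ∂ν ≤ ∫ ω, h (s ω, t ω) ∂ν + ε / 2 := by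
    -- The penalized supremum is controlled only from above; the maximum with `h (s ω, t ω)` turns
    -- this into genuine convergence.
    have hlim : Tendsto (fun R : ℕ => ∫ ω, max (max (-C) (penalizedSup M R h (f ω, g ω)))
        (h (s ω, t ω)) ∂ν) atTop (𝓝 (∫ ω, h (s ω, t ω) ∂ν)) := by
      refine tendsto_integral_filter_of_dominated_convergence (fun _ => C) ?_ ?_
        (integrable_const C) ?_
      · filter_upwards [eventually_ge_atTop M] with R hR
        exact (hmeas R hR).sup hst
      · filter_upwards [eventually_ge_atTop M] with R hR
        exact .of_forall fun ω => abs_max_le_max_abs_abs.trans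
          (max_le (abs_max_penalizedSup_le hR hh _) (hh _))
      · filter_upwards [hcont, hs, ht] with ω h1 h2 h3
        rw [Metric.tendsto_nhds]
        intro e he
        filter_upwards [eventually_penalizedSup_le M hc hh (p := (f ω, g ω)) h1.1 h1.2 h2 h3
          (half_pos he)] with R hR
        rw [Real.dist_eq, abs_of_nonneg (sub_nonneg.2 (le_max_right _ _))]
        have := max_le hR (by linarith : h (s ω, t ω) ≤ h (s ω, t ω) + e / 2)
        linarith
    obtain ⟨R, hR, hMR⟩ := ((hlim.eventually_lt_const
      (show ∫ ω, h (s ω, t ω) ∂ν < ∫ ω, h (s ω, t ω) ∂ν + ε / 2 by linarith)).and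
      (eventually_ge_atTop M)).exists
    refine ⟨R, hMR, (integral_mono ?_ ?_ fun ω => le_max_left _ _).trans hR.le⟩
    · exact integrable_of_abs_le (hmeas R hMR) fun ω => abs_max_penalizedSup_le hMR hh _
    · exact integrable_of_abs_le ((hmeas R hMR).sup hst) fun ω => abs_max_le_max_abs_abs.trans
          (max_le (abs_max_penalizedSup_le hMR hh _) (hh _))
  have hemeas : ∀ δ : ℝ, AEStronglyMeasurable
      (fun ω => min (2 * C) (R * δ * (2 * (g ω).rhoBall R 0 + 1))) ν := fun δ =>
    aestronglyMeasurable_comp hfg (φ := fun p => min (2 * C) (R * δ * (2 * p.2.rhoBall R 0 + 1)))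
      (continuous_const.min (continuous_const.mul ((continuous_const.mul
        ((LocBdd.continuous_rhoBall R 0).comp continuous_snd)).add continuous_const)))
  have hebound : ∀ δ : ℝ, 0 ≤ δ → ∀ ω,
      |min (2 * C) (R * δ * (2 * (g ω).rhoBall R 0 + 1))| ≤ 2 * C := fun δ hδ ω => by
    rw [abs_of_nonneg (min_error_mem hC hδ (f ω, g ω))]
    exact min_le_left _ _
  have hlim : Tendsto (fun δ : ℝ => ∫ ω, min (2 * C) (R * δ * (2 * (g ω).rhoBall R 0 + 1)) ∂ν)
      (𝓝[>] 0) (𝓝 (∫ _, (0 : ℝ) ∂ν)) := by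
    refine tendsto_integral_filter_of_dominated_convergence (fun _ => 2 * C)
      (.of_forall hemeas) ?_ (integrable_const _) (.of_forall fun ω => ?_)
    · filter_upwards [self_mem_nhdsWithin] with δ hδ
      exact .of_forall (hebound δ (le_of_lt hδ))
    · have : Continuous fun δ : ℝ => min (2 * C) (R * δ * (2 * (g ω).rhoBall R 0 + 1)) := by
        fun_prop
      have h0 := (this.tendsto 0).mono_left (nhdsWithin_le_nhds (s := Set.Ioi 0))
      simpa [hC] using h0
  rw [integral_zero] at hlim
  obtain ⟨δ, hδ, hδ0⟩ :=
    ((hlim.eventually_lt_const (half_pos hε)).and self_mem_nhdsWithin).exists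
  have hδ0 : 0 < δ := hδ0
  refine ⟨R, hMR, δ, hδ0, ?_⟩
  unfold dominant
  rw [integral_add
    (integrable_of_abs_le (hmeas R hMR) fun ω => abs_max_penalizedSup_le hMR hh _)
    (integrable_of_abs_le (hemeas δ) (hebound δ hδ0.le))]
  linarith

/-- Four errors of `ε / 4`: replacing the dominant by `h` at the limit point, weak convergence, the
tolerance `R * η`, and the exceptional set where the point leaves the ball or fails to be an
approximate minimizer. -/
theorem eventually_outerExp_le [IsProbabilityMeasure ν] [ProperSpace E] [ProperSpace F]
    {Ω : ℕ → Type*} [∀ n, MeasurableSpace (Ω n)] {μ : ∀ n, Measure (Ω n)}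
    [∀ n, IsProbabilityMeasure (μ n)]
    {H : ∀ n, Ω n → E × F → ℝ} {f_ : ∀ n, Ω n → LocBdd E} {g_ : ∀ n, Ω n → LocBdd (E × F)}
    {x_ : ∀ n, Ω n → E × F} {s : Ω' → E} {t : Ω' → F}
    {α β : ℕ → ℝ} (hα : ∀ n, 0 < α n) (hβ : ∀ n, 0 < β n) (hβα : β =o[atTop] α)
    (hH : ∀ n ω s t, H n ω (s, t) = α n * f_ n ω s + β n * g_ n ω (s, t))
    (hconv : WeakConv μ ν (fun n ω => (f_ n ω, g_ n ω)) (fun ω => (f ω, g ω)))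
    (hcont : ∀ᵐ ω ∂ν, Continuous (f ω) ∧ Continuous (g ω))
    (hmin : ApproxMinimizer μ H x_ β) (htight : BoundedInOuterProb μ x_)
    (hs : ∀ᵐ ω ∂ν, IsUniqueMin (f ω) (s ω))
    (ht : ∀ᵐ ω ∂ν, IsUniqueMin (fun t => g ω (s ω, t)) (t ω))
    (h : BoundedContinuousFunction (E × F) ℝ)
    (hst : AEStronglyMeasurable (fun ω => h (s ω, t ω)) ν) {ε : ℝ} (hε : 0 < ε) :
    ∀ᶠ n in atTop, outerExp (μ n) (fun ω => h (x_ n ω)) ≤ ∫ ω, h (s ω, t ω) ∂ν + ε := by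
  set C := ‖h‖
  have hh : ∀ x, |h x| ≤ C := h.norm_coe_le_norm
  have hC : 0 ≤ C := norm_nonneg h
  have hκ : 0 < ε / (4 * (4 * C + 1)) := by positivity
  -- The exceptional set has measure at most `2 * κ` and costs `2 * C` there, and `4 * C * κ ≤ ε /
  -- 4`.
  set κ := ε / (4 * (4 * C + 1)) with hκdef
  obtain ⟨M₀, hM₀⟩ := htight (ENNReal.ofReal κ) (by simpa using hκ)
  obtain ⟨M, hM⟩ := exists_nat_ge M₀
  obtain ⟨R, hMR, δ, hδ, hint⟩ := exists_integral_dominant_le h.continuous hh hconv.aemeasurable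
    hcont hs ht hst M (show 0 < ε / 4 by positivity)
  let Φ : BoundedContinuousFunction (LocBdd E × LocBdd (E × F)) ℝ :=
    .ofNormedAddCommGroup (dominant M R C δ h)
      (continuous_dominant hMR (fun x => le_of_abs_le (hh x)) δ) (3 * C)
      (abs_dominant_le hMR hh hδ.le)
  have hΦ := (hconv.tendsto Φ).eventually_lt_const
    (show ∫ ω, Φ (f ω, g ω) ∂ν < ∫ ω, Φ (f ω, g ω) ∂ν + ε / 4 by linarith)
  have hΦint : ∫ ω, Φ (f ω, g ω) ∂ν ≤ ∫ ω, h (s ω, t ω) ∂ν + ε / 4 := hint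
  have hη : 0 < min 1 (ε / (4 * (R + 1))) := by positivity
  set η := min 1 (ε / (4 * (R + 1))) with hηdef
  have hRη : R * η ≤ ε / 4 := by
    have h1 : η ≤ ε / (4 * (R + 1)) := min_le_right _ _
    rw [le_div_iff₀ (by positivity)] at h1
    nlinarith
  have hratio : ∀ᶠ n in atTop, β n / α n ≤ δ :=
    (hβα.tendsto_div_nhds_zero.eventually_lt_const hδ).mono fun _ h => h.le
  have hmin' := (hmin η hη).eventually_le_const (show 0 < ENNReal.ofReal κ by simpa using hκ)
  filter_upwards [hM₀, hΦ, hratio, hmin'] with n h1 h2 h3 h4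
  set A : Set (Ω n) :=
    {ω | M₀ < ‖x_ n ω‖} ∪ {ω | ∃ y, H n ω y + η * β n < H n ω (x_ n ω)} with hA
  have hμA : (μ n).real A ≤ 2 * κ := by
    refine ENNReal.toReal_le_of_le_ofReal (by positivity) ?_
    rw [two_mul, ENNReal.ofReal_add hκ.le hκ.le]
    exact (measure_union_le _ _).trans (add_le_add h1 h4)
  have hkey : outerExp (μ n) (fun ω => h (x_ n ω)) ≤
      outerExp (μ n) (fun ω => Φ (f_ n ω, g_ n ω)) + R * η + 2 * C * (μ n).real A := by
    refine outerExp_le_add (fun ω => hh _) (fun ω => abs_dominant_le hMR hh hδ.le _)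
      (fun ω hω => ?_) fun ω => ?_
    · simp only [hA, Set.mem_union, Set.mem_ofPred_eq, not_or, not_lt, not_exists] at hω
      refine le_dominant_add hMR hh (hα n) (hβ n) hη.le (min_le_left _ _) h3 (hω.1.trans hM)
        fun y => ?_
      have := hω.2 y
      rw [← Prod.mk.eta (p := x_ n ω), ← Prod.mk.eta (p := y), hH, hH] at this
      exact this
    · have h5 := neg_le_dominant (M := M) (R := R) hh hδ.le (f_ n ω, g_ n ω)
      have h6 := le_of_abs_le (hh (x_ n ω))
      have h7 : 0 ≤ R * η := by positivity
      change h (x_ n ω) ≤ dominant M R C δ h (f_ n ω, g_ n ω) + R * η + 2 * C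
      linarith
  have h5 : 2 * C * (μ n).real A ≤ ε / 4 := by
    have h6 : κ * (4 * (4 * C + 1)) = ε := div_mul_cancel₀ _ (by positivity)
    have h7 := mul_le_mul_of_nonneg_left hμA (show 0 ≤ 2 * C by positivity)
    nlinarith
  linarith

end Limit

end MixedRates

/-! ### The main theorem. -/

theorem theorem1 {d₁ d₂ : ℕ}
    {Ω : ℕ → Type*} [∀ n, MeasurableSpace (Ω n)]
    (μ : ∀ n, Measure (Ω n)) [∀ n, IsProbabilityMeasure (μ n)]
    {Ω' : Type*} [MeasurableSpace Ω'] (ν : Measure Ω') [IsProbabilityMeasure ν]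
    (H : ∀ n, Ω n → EuclideanSpace ℝ (Fin d₁) × EuclideanSpace ℝ (Fin d₂) → ℝ)
    (f_ : ∀ n, Ω n → MixedRates.LocBdd (EuclideanSpace ℝ (Fin d₁)))
    (g_ : ∀ n, Ω n →
      MixedRates.LocBdd (EuclideanSpace ℝ (Fin d₁) × EuclideanSpace ℝ (Fin d₂)))
    (f : Ω' → MixedRates.LocBdd (EuclideanSpace ℝ (Fin d₁)))
    (g : Ω' → MixedRates.LocBdd (EuclideanSpace ℝ (Fin d₁) × EuclideanSpace ℝ (Fin d₂)))
    (s_ : ∀ n, Ω n → EuclideanSpace ℝ (Fin d₁))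
    (t_ : ∀ n, Ω n → EuclideanSpace ℝ (Fin d₂))
    (s' : Ω' → EuclideanSpace ℝ (Fin d₁)) (t' : Ω' → EuclideanSpace ℝ (Fin d₂))
    (α β : ℕ → ℝ) (hα : ∀ n, 0 < α n) (hβ : ∀ n, 0 < β n)
    (hβα : Asymptotics.IsLittleO atTop β α)
    (hH : ∀ n ω s t, H n ω (s, t) = α n * f_ n ω s + β n * g_ n ω (s, t))
    (hconv : MixedRates.WeakConv μ ν (fun n ω => (f_ n ω, g_ n ω)) (fun ω => (f ω, g ω)))
    (hcont : ∀ᵐ ω ∂ν, Continuous (f ω) ∧ Continuous (g ω))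
    (hmin : MixedRates.ApproxMinimizer μ H (fun n ω => (s_ n ω, t_ n ω)) β)
    (htight : MixedRates.BoundedInOuterProb μ (fun n ω => (s_ n ω, t_ n ω)))
    (hs' : ∀ᵐ ω ∂ν, MixedRates.IsUniqueMin (f ω) (s' ω))
    (ht' : ∀ᵐ ω ∂ν, MixedRates.IsUniqueMin (fun t => g ω (s' ω, t)) (t' ω)) :
    MixedRates.WeakConv μ ν (fun n ω => (s_ n ω, t_ n ω)) (fun ω => (s' ω, t' ω)) := by
  obtain ⟨hsm, htm⟩ := MixedRates.aemeasurable_lexMin hconv.aemeasurable hcont hs' ht'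
  have hst := hsm.prodMk htm
  refine ⟨by rwa [BorelSpace.measurable_eq
    (α := EuclideanSpace ℝ (Fin d₁) × EuclideanSpace ℝ (Fin d₂))] at hst, fun h => ?_⟩
  have hmeas : ∀ k : BoundedContinuousFunction
      (EuclideanSpace ℝ (Fin d₁) × EuclideanSpace ℝ (Fin d₂)) ℝ,
      AEStronglyMeasurable (fun ω => k (s' ω, t' ω)) ν := fun k =>
    (k.continuous.measurable.comp_aemeasurable hst).aestronglyMeasurable
  rw [Metric.tendsto_nhds]
  intro ε hε
  -- The bound for `-h` controls the inner expectation of `h` from below.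
  filter_upwards [MixedRates.eventually_outerExp_le hα hβ hβα hH hconv hcont hmin htight hs' ht' h
      (hmeas h) (half_pos hε),
    MixedRates.eventually_outerExp_le hα hβ hβα hH hconv hcont hmin htight hs' ht' (-h)
      (hmeas (-h)) (half_pos hε)] with n h1 h2
  have h3 := MixedRates.neg_outerExp_neg_le (μ := μ n) (T := fun ω => h (s_ n ω, t_ n ω))
    fun ω => h.norm_coe_le_norm _
  simp only [BoundedContinuousFunction.coe_neg, Pi.neg_apply, integral_neg] at h2
  rw [Real.dist_eq, abs_lt]
  constructor <;> linarith
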